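/- **Model.** Let $K\ge 0$, $N\ge 2$, $N_t\ge 2$ be integers and $c,\lambda_c,T_s,\sigma>0$, $d=\lambda_c/2$. Alice is at $p^\star\in\mathbb R^2$, Eve at $z\in\mathbb R^2$, scatterers at $v_1,\dots,v_K\in\mathbb R^2$, and $v_0=z$. Path $k=0,\dots,K$ has coefficient $\gamma_k\in\mathbb C\setminus\{0\}$, delay $\tau^\star_k=(\|z-v_k\|+\|p^\star-v_k\|)/c$ and angle $\theta^\star_k=\arctan\frac{v_{k,y}-p^\star_y}{v_{k,x}-p^\star_x}\in(-\frac\pi2,\frac\pi2]$ (equal to $\frac\pi2$ if $v_{k,x}=p^\star_x$). For $t_1<t_2$ let $(x)_{(t_1,t_2]}$ be the representative of $x$ modulo $t_2-t_1$ in $(t_1,t_2]$. For real shifts $\Delta_\tau,\Delta_\theta$ put $$\bar\tau_k=(\tau_k^\star+\Delta_\tau)_{(0,NT_s]},\qquad \bar\theta_k=\arcsin\big((\sin\theta_k^\star+\sin\Delta_\theta)_{(-1,1]}\big),$$ and assume $\cos\bar\theta_k\ne0$ for all $k$. Let $k_{\min}\in\arg\min_k\bar\tau_k$. With $\alpha(\theta)=(e^{-j2\pi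 m d\sin\theta/\lambda_c})_{m=0}^{N_t-1}$ and $\bar h^{(n)}=\sum_k\gamma_k e^{-j2\pi n\bar\tau_k/(NT_s)}\alpha(\bar\theta_k)^{\mathrm H}$, let $\bar u^{(g,n)}=\bar h^{(n)}s^{(g,n)}$, where the pilots $s^{(g,n)}$ ($g\ge1$, $0\le n<N$) are random vectors in $\mathbb C^{N_t}$, for each $n$ independent and identically distributed in $g$, with $\mathbb E\{s^{(g,n)}(s^{(g,n)})^{\mathrm H}\}=\frac1{N_t}I_{N_t}$. Let $\bar\eta=(\bar\tau,\bar\theta)$ and $\bar\xi=(\bar\tau,\bar\theta,\Re\gamma,\Im\gamma)\in\mathbb R^{4(K+1)}$. The Fisher information matrix from $G$ pilots per sub-carrier is $$J_{\bar\xi}=\frac2{\sigma^2}\sum_{n=0}^{N-1}\sum_{g=1}^G\Re\Big\{\Big(\frac{\partial\bar u^{(g,n)}}{\partial\bar\xi}\Big)^{\mathrm H}\frac{\partial\bar u^{(g,n)}}{\partial\bar\xi}\Big\}=\begin{bmatrix}J^{(1)}&J^{(2)}\\J^{(3)}&J^{(4)}\end{bmatrix}$$ (four square blocks of size $2(K+1)$),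 and $J_{\bar\eta}=J^{(1)}-J^{(2)}(J^{(4)})^{-1}J^{(3)}$ is the effective one for $\bar\eta$. Given the pilots, Eve's channel estimate is $\hat\eta\sim\mathcal N(\bar\eta,J_{\bar\eta}^{-1})$. For channel parameters $\eta=(\tau,\theta)$ let $\bar p(\eta)=z-c\,\tau_{k_{\min}}(\cos\theta_{k_{\min}},\sin\theta_{k_{\min}})$, and let $\bar p^\star=\bar p(\bar\eta)$ be the pseudo-true position. A (measurable) position estimator $\hat p_{\rm Eve}=\hat p(\hat\eta)$ is *misspecified-unbiased* if, for all $\eta$ in a neighbourhood of $\bar\eta$, its mean under $\hat\eta\sim\mathcal N(\eta,J_{\bar\eta}^{-1})$ (with the matrix $J_{\bar\eta}$ held fixed) exists and equals $\bar p(\eta)$. **Proposition.** For every $\psi>0$, with probability $1$ over the pilots there is a positive integer $\mathcal G$ (which may depend on the realization of the pilots) such that, for every $G\ge\mathcal G$ for which the paths are orthogonal, i.e. all entries of $J_{\bar\xi}$ that belong to two different paths vanish, every misspecified-unbiased position estimator satisfies $$\mathbb E\{\|\hat p_{\rm Eve}-p^\star\|_2^2\}\ \ge\ C_1+\frac{C_2\,\bar\tau_{k_{\min}}^2}{\cos^2\bar\theta_{k_{\min}}}+\|\bar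 p^\star-p^\star\|_2^2,$$ where the expectation is over $\hat\eta\sim\mathcal N(\bar\eta,J_{\bar\eta}^{-1})$ given the pilots (and may be $+\infty$), and $$C_1=\frac{3\sigma^2c^2NT_s^2}{2G|\gamma_{k_{\min}}|^2\pi^2(N^2-1)}-\frac\psi G,\qquad C_2=\frac{3\sigma^2c^2\lambda_c^2}{2G|\gamma_{k_{\min}}|^2\pi^2d^2N(N_t^2-1)} .$$ -/

import Mathlib

open MeasureTheory ProbabilityTheory Filter Topology
open scoped ENNReal ComplexConjugate Matrix

noncomputable section

/-- The plane with its Euclidean norm. -/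
abbrev Plane : Type := EuclideanSpace ℝ (Fin 2)

/-- Indices of the location-relevant channel parameters `η̄ = (τ̄, θ̄)`:
`(0, k)` is the delay and `(1, k)` the angle of path `k = 0, …, K`. -/
abbrev EtaIdx (K : ℕ) : Type := Fin 2 × Fin (K + 1)

/-- Indices of all channel parameters `ξ̄ = (τ̄, θ̄, Re γ, Im γ)`: `inl` is the block `η̄`;
`inr (0, k)` and `inr (1, k)` are the real and the imaginary part of the coefficient of
path `k`. -/
abbrev XiIdx (K : ℕ) : Type := EtaIdx K ⊕ EtaIdx K

/-- The path that a channel parameter belongs to. -/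
def pathOf {K : ℕ} : XiIdx K → Fin (K + 1)
  | Sum.inl i => i.2
  | Sum.inr i => i.2

/-- `(x)_{(t₁, t₂]} = x - ⌊(x - t₁)/(t₂ - t₁)⌋ (t₂ - t₁)`, where the bracket is the largest
integer strictly below its argument, so that the result lies in `(t₁, t₂]`. -/
def wrapIoc (t₁ t₂ x : ℝ) : ℝ := x - ((⌈(x - t₁) / (t₂ - t₁)⌉ - 1 : ℤ) : ℝ) * (t₂ - t₁)

/-- The data of the system: `K` scatterers, `N` sub-carriers, `Nt` transmit antennas. -/
structure SpoofModel (K N Nt : ℕ) where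
  /-- speed of light -/
  c : ℝ
  /-- carrier wavelength -/
  lam : ℝ
  /-- antenna spacing -/
  d : ℝ
  /-- sampling period -/
  Ts : ℝ
  /-- standard deviation of the receiver noise -/
  σ : ℝ
  /-- true position of the transmitter (Alice) -/
  p : Plane
  /-- position of the eavesdropper (Eve) -/
  z : Plane
  /-- positions of the scatterers -/
  scat : Fin K → Plane
  /-- channel coefficients of the paths -/
  γ : Fin (K + 1) → ℂ
  /-- delay shift -/
  Δτ : ℝ
  /-- angle shift -/
  Δθ : ℝ

namespace SpoofModel

variable {K N Nt : ℕ} (M : SpoofModel K N Nt)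

/-- `v₀ = z` (line of sight) and `v₁, …, v_K` the scatterers. -/
def v : Fin (K + 1) → Plane := Fin.cons M.z M.scat

/-- True time of arrival of path `k`. -/
def toa (k : Fin (K + 1)) : ℝ := (‖M.v 0 - M.v k‖ + ‖M.p - M.v k‖) / M.c

/-- True angle of departure of path `k`, in `(-π/2, π/2]`; the value is `π/2` on the vertical
line, where the slope is infinite. -/
def aod (k : Fin (K + 1)) : ℝ :=
  if M.v k 0 = M.p 0 then Real.pi / 2
  else Real.arctan ((M.v k 1 - M.p 1) / (M.v k 0 - M.p 0))

/-- Shifted delay `τ̄_k`. -/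
def toaBar (k : Fin (K + 1)) : ℝ := wrapIoc 0 (N * M.Ts) (M.toa k + M.Δτ)

/-- Shifted angle `θ̄_k`. -/
def aodBar (k : Fin (K + 1)) : ℝ :=
  Real.arcsin (wrapIoc (-1) 1 (Real.sin (M.aod k) + Real.sin M.Δθ))

/-- The vector `η̄` of shifted delays and angles. -/
def etaBar : EuclideanSpace ℝ (EtaIdx K) :=
  WithLp.toLp 2 fun i => ![M.toaBar i.2, M.aodBar i.2] i.1

/-- The vector `ξ̄` of all channel parameters. -/
def xiBar : XiIdx K → ℝ
  | Sum.inl i => M.etaBar i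
  | Sum.inr i => ![(M.γ i.2).re, (M.γ i.2).im] i.1

/-- The steering vector `α(θ)`. -/
def steering (θ : ℝ) (m : Fin Nt) : ℂ :=
  Complex.exp (-Complex.I * ((2 * Real.pi * (m : ℕ) * M.d * Real.sin θ / M.lam : ℝ) : ℂ))

/-- The (row) virtual channel `∑ₖ γₖ exp(-j 2π n τₖ / (N Tₛ)) α(θₖ)ᴴ` of sub-carrier `n`, for
channel parameters `ξ`. -/
def channel (n : Fin N) (ξ : XiIdx K → ℝ) (m : Fin Nt) : ℂ :=
  ∑ k : Fin (K + 1),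
    ((ξ (Sum.inr (0, k)) : ℂ) + Complex.I * (ξ (Sum.inr (1, k)) : ℂ)) *
      Complex.exp
        (-Complex.I * ((2 * Real.pi * (n : ℕ) * ξ (Sum.inl (0, k)) / (N * M.Ts) : ℝ) : ℂ)) *
      conj (M.steering (ξ (Sum.inl (1, k))) m)

/-- Noise-free received sample `ū = h̄ s` for the pilot vector `s`. -/
def signal (n : Fin N) (s : Fin Nt → ℂ) (ξ : XiIdx K → ℝ) : ℂ :=
  ∑ m, M.channel n ξ m * s m

/-- Partial derivative of `ū` with respect to the `i`-th channel parameter, at `ξ̄`. -/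
def dsignal (n : Fin N) (s : Fin Nt → ℂ) (i : XiIdx K) : ℂ :=
  deriv (fun t : ℝ => M.signal n s (Function.update M.xiBar i t)) (M.xiBar i)

/-- Fisher information matrix for `ξ̄` from the first `G` pilots `s g n` of each sub-carrier `n`
(the pilots are numbered from `0`). -/
def fim (s : ℕ → Fin N → Fin Nt → ℂ) (G : ℕ) : Matrix (XiIdx K) (XiIdx K) ℝ :=
  Matrix.of fun i j => 2 / M.σ ^ 2 *
    ∑ n : Fin N, ∑ g ∈ Finset.range G, (conj (M.dsignal n (s g n) i) * M.dsignal n (s g n) j).re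

/-- Orthogonality of the paths: all cross-path entries of the Fisher information vanish. -/
def PathsOrthogonal (s : ℕ → Fin N → Fin Nt → ℂ) (G : ℕ) : Prop :=
  ∀ i j : XiIdx K, pathOf i ≠ pathOf j → M.fim s G i j = 0

/-- Effective Fisher information matrix for `η̄`, with the channel coefficients as nuisance
parameters. -/
def effFim (s : ℕ → Fin N → Fin Nt → ℂ) (G : ℕ) : Matrix (EtaIdx K) (EtaIdx K) ℝ :=
  (M.fim s G).toBlocks₁₁ -
    (M.fim s G).toBlocks₁₂ * (M.fim s G).toBlocks₂₂⁻¹ * (M.fim s G).toBlocks₂₁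

/-- The Gaussian law of Eve's channel estimate `η̂ = η + ε` when the location-relevant channel
parameters are `η`; the covariance of `ε` is the inverse effective Fisher information at `η̄`. -/
def estLaw (s : ℕ → Fin N → Fin Nt → ℂ) (G : ℕ) (η : EuclideanSpace ℝ (EtaIdx K)) :
    Measure (EuclideanSpace ℝ (EtaIdx K)) :=
  multivariateGaussian η (M.effFim s G)⁻¹

/-- The pseudo-true position of the transmitter for channel parameters `η` when path `k` is taken
for the line of sight: `z - c τₖ (cos θₖ, sin θₖ)`. -/
def pseudoPos (k : Fin (K + 1)) (η : EuclideanSpace ℝ (EtaIdx K)) : Plane :=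
  M.z - (M.c * η (0, k)) • !₂[Real.cos (η (1, k)), Real.sin (η (1, k))]

/-- `p̂`, a function of the channel estimate, is a misspecified-unbiased estimator of the position
(with path `k` taken for the line of sight): for all channel parameters `η` in some neighbourhood
of `η̄`, the mean of `p̂(η̂)` exists and is the pseudo-true position belonging to `η`. -/
def MSUnbiased (s : ℕ → Fin N → Fin Nt → ℂ) (G : ℕ) (k : Fin (K + 1))
    (phat : EuclideanSpace ℝ (EtaIdx K) → Plane) : Prop :=
  ∀ᶠ η in 𝓝 M.etaBar, Integrable phat (M.estLaw s G η) ∧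
    ∫ x, phat x ∂(M.estLaw s G η) = M.pseudoPos k η

/-- The mean squared error of `p̂(η̂)` as an estimate of the true position, in `[0, ∞]`. -/
def mse (s : ℕ → Fin N → Fin Nt → ℂ) (G : ℕ)
    (phat : EuclideanSpace ℝ (EtaIdx K) → Plane) : ℝ≥0∞ :=
  ∫⁻ x, ENNReal.ofReal (‖phat x - M.p‖ ^ 2) ∂(M.estLaw s G M.etaBar)

/-- The constant `C₁`. -/
def C₁ (G : ℕ) (ψ : ℝ) (k : Fin (K + 1)) : ℝ :=
  3 * M.σ ^ 2 * M.c ^ 2 * N * M.Ts ^ 2 /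
      (2 * G * ‖M.γ k‖ ^ 2 * Real.pi ^ 2 * ((N : ℝ) ^ 2 - 1)) - ψ / G

/-- The constant `C₂`. -/
def C₂ (G : ℕ) (k : Fin (K + 1)) : ℝ :=
  3 * M.σ ^ 2 * M.c ^ 2 * M.lam ^ 2 /
    (2 * G * ‖M.γ k‖ ^ 2 * Real.pi ^ 2 * M.d ^ 2 * N * ((Nt : ℝ) ^ 2 - 1))

end SpoofModel

end

/-!
The bound is a Cramér–Rao inequality in a Gaussian location family, evaluated at the almost sure
limit of the Fisher information per pilot.

For the law `N(η, J⁻¹)`, a shift of the mean by `t • eᵢ` is, after whitening, a shift of the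
standard Gaussian measure by a vector `t • a` with `‖a‖² = J i i`. Its likelihood ratio is explicit
(`map_add_right_stdGaussian`), and the Cauchy–Schwarz inequality bounds the squared increment of the
mean of a square-integrable `f` by `(exp (t² ‖a‖²) - 1)` times the variance of `f`
(`sq_integral_shift_sub_le`). Dividing by `t²` and letting `t → 0` gives the Cramér–Rao inequality
`sq_deriv_integral_multivariateGaussian_le`. A finite mean squared error supplies the
square-integrability of the estimator; an infinite one leaves nothing to prove.

The Jacobian of the pseudo-true position has orthogonal columns: the delay moves it radially at rate
`c`, the angle moves it tangentially at rate `c τ`. So the scalar inequality is applied once to the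
radial error with the delay and once to the tangential error with the angle, and the mean squared
error splits into these two parts and the squared bias (`SpoofModel.le_mse`). Only diagonal entries
of the effective information enter.

By the strong law of large numbers the Fisher information divided by `G` converges almost surely to
an explicit matrix `limitFim` (`SpoofModel.tendsto_fim`). If a cross-path entry of this matrix is
non-zero, then the paths are not orthogonal for any large `G`. Otherwise its effective
information matrix is the diagonal matrix of `limitInfo` (`SpoofModel.schurCompl_limitFim`), since
the delay and angle scores become orthogonal after projection along the path coefficient. The
Schur complement is continuous there, so the effective information is positive definite for large
`G`, and its diagonal entries divided by `G` converge to `limitInfo`, which gives the constants `C₁`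
and `C₂`; the margin `ψ` absorbs the error of the limit.
-/

noncomputable section

/-! ### Shifts of Gaussian measures and a Cramér–Rao bound -/

section Gaussian

open scoped RealInnerProductSpace

variable {E : Type*} [NormedAddCommGroup E] [InnerProductSpace ℝ E] [FiniteDimensional ℝ E]
  [MeasurableSpace E] [BorelSpace E]

lemma integral_cexp_inner_stdGaussian (a t : E) :
    ∫ x, Complex.exp ((⟪x, a⟫ : ℝ) + (⟪x, t⟫ : ℝ) * Complex.I) ∂(stdGaussian E)
      = Complex.exp (((‖a‖ ^ 2 - ‖t‖ ^ 2) / 2 : ℝ) + (⟪a, t⟫ : ℝ) * Complex.I) := by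
  rw [stdGaussian, integral_map (Measurable.aemeasurable (by fun_prop))
    (Measurable.aestronglyMeasurable (by fun_prop))]
  set b := stdOrthonormalBasis ℝ E
  have h1 : ∀ x : Fin (Module.finrank ℝ E) → ℝ,
      Complex.exp ((⟪∑ i, x i • b i, a⟫ : ℝ) + (⟪∑ i, x i • b i, t⟫ : ℝ) * Complex.I)
        = ∏ i, Complex.exp (((⟪b i, a⟫ : ℝ) + (⟪b i, t⟫ : ℝ) * Complex.I) * (x i : ℝ)) := by
    intro x
    rw [← Complex.exp_sum]
    congr 1
    simp_rw [sum_inner, real_inner_smul_left, Complex.ofReal_sum, Finset.sum_mul,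
      ← Finset.sum_add_distrib]
    refine Finset.sum_congr rfl fun i _ => ?_
    push_cast; ring
  have h2 : ∀ z : ℂ, ∫ y : ℝ, Complex.exp (z * (y : ℝ)) ∂(gaussianReal 0 1)
      = Complex.exp (z ^ 2 / 2) := by
    intro z
    have := complexMGF_id_gaussianReal (μ := 0) (v := 1) z
    simpa [complexMGF] using this
  simp_rw [h1]
  rw [integral_fintype_prod_eq_prod
    (f := fun i (y : ℝ) =>
      Complex.exp (((⟪b i, a⟫ : ℝ) + (⟪b i, t⟫ : ℝ) * Complex.I) * (y : ℝ)))]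
  simp_rw [h2]
  rw [← Complex.exp_sum]
  congr 1
  have e1 : ‖a‖ ^ 2 = ∑ i, ⟪b i, a⟫ ^ 2 := (b.sum_sq_inner_right a).symm
  have e2 : ‖t‖ ^ 2 = ∑ i, ⟪b i, t⟫ ^ 2 := (b.sum_sq_inner_right t).symm
  have e3 : ⟪a, t⟫ = ∑ i, ⟪b i, a⟫ * ⟪b i, t⟫ := by
    rw [← b.sum_inner_mul_inner a t]
    exact Finset.sum_congr rfl fun i _ => by rw [real_inner_comm]
  rw [e1, e2, e3]
  push_cast
  rw [← Finset.sum_sub_distrib, Finset.sum_div, Finset.sum_mul, ← Finset.sum_add_distrib]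
  refine Finset.sum_congr rfl fun i _ => ?_
  linear_combination (⟪b i, t⟫ : ℂ) ^ 2 / 2 * Complex.I_sq

lemma integrable_exp_inner_stdGaussian (a : E) :
    Integrable (fun x => Real.exp ⟪x, a⟫) (stdGaussian E) := by
  -- a non-integrable function would have integral zero
  have h := integral_cexp_inner_stdGaussian a 0
  have h' : Integrable (fun x : E => Complex.exp ((⟪x, a⟫ : ℝ) + (⟪x, (0 : E)⟫ : ℝ) * Complex.I))
      (stdGaussian E) := by
    by_contra hn
    rw [integral_undef hn] at h
    exact Complex.exp_ne_zero _ h.symm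
  refine h'.re.congr (ae_of_all _ fun x => ?_)
  simp [← Complex.ofReal_exp]

lemma integral_exp_inner_stdGaussian (a : E) :
    ∫ x, Real.exp ⟪x, a⟫ ∂(stdGaussian E) = Real.exp (‖a‖ ^ 2 / 2) := by
  have h := integral_cexp_inner_stdGaussian a 0
  simp only [inner_zero_right, Complex.ofReal_zero, zero_mul, add_zero, ← Complex.ofReal_exp,
    norm_zero, integral_complex_ofReal] at h
  have := Complex.ofReal_injective h
  simpa using this

/-- The likelihood ratio of the standard Gaussian measure shifted by `a` with respect to the
unshifted one. -/
def gaussianShiftRatio (a x : E) : ℝ := Real.exp (⟪x, a⟫ - ‖a‖ ^ 2 / 2)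

@[fun_prop]
lemma measurable_gaussianShiftRatio (a : E) : Measurable (gaussianShiftRatio a) := by
  unfold gaussianShiftRatio; fun_prop

/-- The Cameron–Martin formula in finite dimension. -/
lemma map_add_right_stdGaussian (a : E) :
    (stdGaussian E).map (fun x => x + a)
      = (stdGaussian E).withDensity (fun x => ENNReal.ofReal (gaussianShiftRatio a x)) := by
  have hi : Integrable (gaussianShiftRatio a) (stdGaussian E) := by
    unfold gaussianShiftRatio
    simp_rw [Real.exp_sub]
    exact (integrable_exp_inner_stdGaussian a).div_const _
  have : IsFiniteMeasure
      ((stdGaussian E).withDensity (fun x => ENNReal.ofReal (gaussianShiftRatio a x))) :=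
    isFiniteMeasure_withDensity_ofReal hi.2
  apply Measure.ext_of_charFun
  ext t
  rw [charFun_apply, charFun_apply, integral_map (by fun_prop)
    (Measurable.aestronglyMeasurable (by fun_prop)),
    integral_withDensity_eq_integral_toReal_smul (by fun_prop) (by simp)]
  have h1 : ∀ x : E, Complex.exp ((⟪x + a, t⟫ : ℝ) * Complex.I)
      = Complex.exp ((⟪a, t⟫ : ℝ) * Complex.I) *
        Complex.exp ((⟪x, (0 : E)⟫ : ℝ) + (⟪x, t⟫ : ℝ) * Complex.I) := by
    intro x
    rw [← Complex.exp_add, inner_add_left]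
    congr 1
    simp
    ring
  have h2 : ∀ x : E, (ENNReal.ofReal (gaussianShiftRatio a x)).toReal •
        Complex.exp ((⟪x, t⟫ : ℝ) * Complex.I)
      = Complex.exp ((-‖a‖ ^ 2 / 2 : ℝ)) *
        Complex.exp ((⟪x, a⟫ : ℝ) + (⟪x, t⟫ : ℝ) * Complex.I) := by
    intro x
    rw [gaussianShiftRatio, ENNReal.toReal_ofReal (Real.exp_pos _).le, Complex.real_smul,
      Complex.ofReal_exp, ← Complex.exp_add, ← Complex.exp_add]
    congr 1
    push_cast; ring
  simp_rw [h1, h2]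
  rw [integral_const_mul, integral_const_mul, integral_cexp_inner_stdGaussian,
    integral_cexp_inner_stdGaussian, ← Complex.exp_add, ← Complex.exp_add]
  congr 1
  simp
  ring

lemma integral_add_right_stdGaussian {f : E → ℝ} (hf : Measurable f) (a : E) :
    ∫ x, f (x + a) ∂(stdGaussian E) = ∫ x, f x * gaussianShiftRatio a x ∂(stdGaussian E) := by
  rw [← integral_map (φ := fun x => x + a) (f := f) (by fun_prop) hf.aestronglyMeasurable,
    map_add_right_stdGaussian, integral_withDensity_eq_integral_toReal_smul (by fun_prop) (by simp)]
  refine integral_congr_ae (ae_of_all _ fun x => ?_)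
  simp [ENNReal.toReal_ofReal (Real.exp_pos _).le, gaussianShiftRatio, mul_comm]

omit [FiniteDimensional ℝ E] [MeasurableSpace E] [BorelSpace E] in
lemma gaussianShiftRatio_sq (a x : E) :
    gaussianShiftRatio a x ^ 2 = Real.exp (⟪x, (2 : ℝ) • a⟫) * Real.exp (-‖a‖ ^ 2) := by
  rw [gaussianShiftRatio, ← Real.exp_nat_mul, ← Real.exp_add, real_inner_smul_right]
  congr 1
  push_cast; ring

lemma memLp_gaussianShiftRatio (a : E) : MemLp (gaussianShiftRatio a) 2 (stdGaussian E) := by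
  rw [memLp_two_iff_integrable_sq (by fun_prop)]
  simp_rw [gaussianShiftRatio_sq]
  exact (integrable_exp_inner_stdGaussian _).mul_const _

lemma integral_gaussianShiftRatio (a : E) :
    ∫ x, gaussianShiftRatio a x ∂(stdGaussian E) = 1 := by
  have := integral_add_right_stdGaussian (E := E) (f := fun _ => 1) measurable_const a
  simpa using this.symm

lemma integral_gaussianShiftRatio_sub_one_sq (a : E) :
    ∫ x, (gaussianShiftRatio a x - 1) ^ 2 ∂(stdGaussian E) = Real.exp (‖a‖ ^ 2) - 1 := by
  have hL := memLp_gaussianShiftRatio a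
  have hi := hL.integrable one_le_two
  have h2 : ∫ x, gaussianShiftRatio a x ^ 2 ∂(stdGaussian E) = Real.exp (‖a‖ ^ 2) := by
    simp_rw [gaussianShiftRatio_sq]
    rw [integral_mul_const, integral_exp_inner_stdGaussian, ← Real.exp_add, norm_smul]
    congr 1
    norm_num
    ring
  have h3 : ∀ x : E, (gaussianShiftRatio a x - 1) ^ 2
      = gaussianShiftRatio a x ^ 2 - (2 * gaussianShiftRatio a x - 1) := fun x => by ring
  simp_rw [h3]
  have i2 : Integrable (fun x => 2 * gaussianShiftRatio a x - 1) (stdGaussian E) :=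
    (hi.const_mul 2).sub (integrable_const 1)
  rw [integral_sub hL.integrable_sq i2,
    integral_sub (hi.const_mul 2) (integrable_const 1), integral_const_mul, h2,
    integral_gaussianShiftRatio]
  simp
  ring

lemma sq_integral_mul_le {Ω : Type*} [MeasurableSpace Ω] {μ : Measure Ω} {f g : Ω → ℝ}
    (hf : MemLp f 2 μ) (hg : MemLp g 2 μ) :
    (∫ x, f x * g x ∂μ) ^ 2 ≤ (∫ x, f x ^ 2 ∂μ) * ∫ x, g x ^ 2 ∂μ := by
  -- the discriminant of the non-negative quadratic `r ↦ ∫ (f + r g) ^ 2`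
  have hfg : Integrable (fun x => f x * g x) μ := hf.integrable_mul hg
  have key : ∀ r : ℝ, 0 ≤ (∫ x, g x ^ 2 ∂μ) * (r * r) + (2 * ∫ x, f x * g x ∂μ) * r
      + ∫ x, f x ^ 2 ∂μ := by
    intro r
    have : ∫ x, (f x + r * g x) ^ 2 ∂μ = (∫ x, g x ^ 2 ∂μ) * (r * r)
        + (2 * ∫ x, f x * g x ∂μ) * r + ∫ x, f x ^ 2 ∂μ := by
      have e : ∀ x, (f x + r * g x) ^ 2
          = (r * r) * g x ^ 2 + ((2 * r) * (f x * g x) + f x ^ 2) := fun x => by ring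
      simp_rw [e]
      have i2 : Integrable (fun x => 2 * r * (f x * g x) + f x ^ 2) μ :=
        (hfg.const_mul (2 * r)).add hf.integrable_sq
      rw [integral_add (hg.integrable_sq.const_mul _) i2,
        integral_add (hfg.const_mul (2 * r)) hf.integrable_sq, integral_const_mul,
        integral_const_mul]
      ring
    rw [← this]
    exact integral_nonneg fun x => sq_nonneg _
  have := discrim_le_zero key
  rw [discrim] at this
  linarith

/-- The Chapman–Robbins inequality for a Gaussian shift family. -/
lemma sq_integral_shift_sub_le {f : E → ℝ} (hf : Measurable f)
    (hf2 : MemLp f 2 (stdGaussian E)) (a : E) :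
    (∫ x, f (x + a) ∂(stdGaussian E) - ∫ x, f x ∂(stdGaussian E)) ^ 2
      ≤ (∫ x, (f x - ∫ y, f y ∂(stdGaussian E)) ^ 2 ∂(stdGaussian E)) *
        (Real.exp (‖a‖ ^ 2) - 1) := by
  set c := ∫ x, f x ∂(stdGaussian E) with hc
  have hL := memLp_gaussianShiftRatio a
  have h1 : MemLp (fun x => f x - c) 2 (stdGaussian E) := hf2.sub (memLp_const c)
  have h2 : MemLp (fun x => gaussianShiftRatio a x - 1) 2 (stdGaussian E) :=
    hL.sub (memLp_const 1)
  have e : ∫ x, (f x - c) * (gaussianShiftRatio a x - 1) ∂(stdGaussian E)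
      = ∫ x, f (x + a) ∂(stdGaussian E) - c := by
    rw [integral_add_right_stdGaussian hf]
    have e' : ∀ x, (f x - c) * (gaussianShiftRatio a x - 1)
      = f x * gaussianShiftRatio a x - (c * gaussianShiftRatio a x + (f x - c)) :=
        fun x => by ring
    simp_rw [e']
    have i1 : Integrable (fun x => f x * gaussianShiftRatio a x) (stdGaussian E) :=
      hf2.integrable_mul hL
    have i2 : Integrable (fun x => c * gaussianShiftRatio a x) (stdGaussian E) :=
      (hL.integrable one_le_two).const_mul c
    have i3 := hf2.integrable one_le_two
    have i4 : Integrable (fun x => f x - c) (stdGaussian E) := i3.sub (integrable_const c)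
    have i5 : Integrable (fun x => c * gaussianShiftRatio a x + (f x - c)) (stdGaussian E) :=
      i2.add i4
    rw [integral_sub i1 i5, integral_add i2 i4, integral_sub i3 (integrable_const c),
      integral_const_mul, integral_gaussianShiftRatio]
    simp [← hc]
  rw [← e, ← integral_gaussianShiftRatio_sub_one_sq a]
  exact sq_integral_mul_le h1 h2

/-- The Cramér–Rao inequality for a Gaussian shift family, as the limit of small shifts in the
Chapman–Robbins inequality; no differentiation under the integral sign is needed. -/
lemma sq_deriv_integral_shift_le {f : E → ℝ} (hf : Measurable f)
    (hf2 : MemLp f 2 (stdGaussian E)) (a : E) {D : ℝ}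
    (hD : HasDerivAt (fun t : ℝ => ∫ x, f (x + t • a) ∂(stdGaussian E)) D 0) :
    D ^ 2 ≤ ‖a‖ ^ 2 * ∫ x, (f x - ∫ y, f y ∂(stdGaussian E)) ^ 2 ∂(stdGaussian E) := by
  set V := ∫ x, (f x - ∫ y, f y ∂(stdGaussian E)) ^ 2 ∂(stdGaussian E)
  have h1 := (hasDerivAt_iff_tendsto_slope_zero.1 hD).pow 2
  have hexp : HasDerivAt (fun u : ℝ => Real.exp (u * ‖a‖ ^ 2)) (‖a‖ ^ 2) 0 := by
    have := ((hasDerivAt_id (0 : ℝ)).mul_const (‖a‖ ^ 2)).exp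
    simpa using this
  have hsq : Tendsto (fun t : ℝ => t ^ 2) (𝓝[≠] 0) (𝓝[≠] 0) := by
    refine tendsto_nhdsWithin_iff.2 ⟨?_, ?_⟩
    · have : Tendsto (fun t : ℝ => t ^ 2) (𝓝 0) (𝓝 (0 ^ 2)) := (continuous_pow 2).tendsto 0
      simpa using this.mono_left nhdsWithin_le_nhds
    · filter_upwards [self_mem_nhdsWithin] with t ht
      simpa using ht
  have h2 := ((hasDerivAt_iff_tendsto_slope_zero.1 hexp).comp hsq).const_mul V
  rw [mul_comm]
  refine le_of_tendsto_of_tendsto h1 h2 ?_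
  filter_upwards [self_mem_nhdsWithin] with t ht
  have ht' : t ≠ 0 := ht
  have hCR := sq_integral_shift_sub_le hf hf2 (t • a)
  rw [norm_smul, mul_pow, Real.norm_eq_abs, sq_abs] at hCR
  simp only [Function.comp, zero_add, smul_eq_mul, zero_smul, add_zero, zero_mul, Real.exp_zero]
  rw [mul_pow, inv_pow]
  calc (t ^ 2)⁻¹ * _ ≤ (t ^ 2)⁻¹ * (V * (Real.exp (t ^ 2 * ‖a‖ ^ 2) - 1)) := by gcongr
    _ = _ := by ring

end Gaussian

section Multivariate

variable {ι : Type*} [Fintype ι] [DecidableEq ι]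

open scoped MatrixOrder RealInnerProductSpace

/-- The scalar Cramér–Rao inequality for the Gaussian location family with information matrix `J`:
the shift along the `i`-th coordinate carries the information `J i i`. -/
lemma sq_deriv_integral_multivariateGaussian_le {J : Matrix ι ι ℝ} (hJ : J.PosDef)
    (m : EuclideanSpace ℝ ι) (i : ι) {f : EuclideanSpace ℝ ι → ℝ} (hf : Measurable f)
    (hf2 : MemLp f 2 (multivariateGaussian m J⁻¹)) {D : ℝ}
    (hD : HasDerivAt (fun t : ℝ => ∫ x, f x
      ∂(multivariateGaussian (m + t • EuclideanSpace.single i (1 : ℝ)) J⁻¹)) D 0) :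
    D ^ 2 ≤ J i i * ∫ x, (f x - ∫ y, f y ∂(multivariateGaussian m J⁻¹)) ^ 2
      ∂(multivariateGaussian m J⁻¹) := by
  set R := Matrix.toEuclideanCLM (𝕜 := ℝ) (CFC.sqrt J⁻¹) with hR
  set e : EuclideanSpace ℝ ι := EuclideanSpace.single i (1 : ℝ) with he
  set a : EuclideanSpace ℝ ι := R (Matrix.toEuclideanCLM (𝕜 := ℝ) J e) with ha
  have hdet : IsUnit J.det := (Matrix.isUnit_iff_isUnit_det _).1 hJ.isUnit
  have hSnn : (0 : Matrix ι ι ℝ) ≤ J⁻¹ := hJ.inv.posSemidef.nonneg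
  have hsq : CFC.sqrt J⁻¹ * CFC.sqrt J⁻¹ = J⁻¹ := CFC.sqrt_mul_sqrt_self _ hSnn
  have hRR : ∀ x, R (R x) = Matrix.toEuclideanCLM (𝕜 := ℝ) J⁻¹ x := by
    intro x
    rw [← hsq, map_mul]; rfl
  -- the shift by `e` is the image of the shift by `a` of the standard Gaussian measure
  have hRa : R a = e := by
    rw [ha, hRR, ← mul_apply_eq_comp, ← map_mul, Matrix.nonsing_inv_mul _ hdet, map_one]
    rfl
  have hsymm : ∀ x y, ⟪R x, y⟫ = ⟪x, R y⟫ := by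
    intro x y
    have hsa : IsSelfAdjoint R := by
      rw [hR]
      have : IsSelfAdjoint (CFC.sqrt J⁻¹) := (CFC.sqrt_nonneg _).isSelfAdjoint
      exact this.map _
    exact hsa.isSymmetric x y
  have hna : ‖a‖ ^ 2 = J i i := by
    rw [← real_inner_self_eq_norm_sq]
    nth_rewrite 1 [ha]
    rw [hsymm, hRa, he]
    simp [EuclideanSpace.inner_single_right, Matrix.ofLp_toEuclideanCLM]
  have hmeas : ∀ m' : EuclideanSpace ℝ ι, Measurable fun x => m' + R x := fun m' => by fun_prop
  have hint : ∀ (m' : EuclideanSpace ℝ ι) {g : EuclideanSpace ℝ ι → ℝ}, Measurable g →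
      ∫ x, g x ∂(multivariateGaussian m' J⁻¹) = ∫ x, g (m' + R x) ∂(stdGaussian _) := by
    intro m' g hg
    rw [multivariateGaussian, integral_map (hmeas m').aemeasurable hg.aestronglyMeasurable]
  have hf2' : MemLp (fun x => f (m + R x)) 2 (stdGaussian (EuclideanSpace ℝ ι)) := by
    rw [multivariateGaussian, memLp_map_measure_iff hf.aestronglyMeasurable
      (hmeas m).aemeasurable] at hf2
    exact hf2
  have hfm : Measurable (fun x => f (m + R x)) := hf.comp (hmeas m)
  have hD' : HasDerivAt (fun t : ℝ => ∫ x, f (m + R (x + t • a)) ∂(stdGaussian _)) D 0 := by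
    refine hD.congr_of_eventuallyEq (Eventually.of_forall fun t => ?_)
    simp only
    rw [hint _ hf]
    refine integral_congr_ae (ae_of_all _ fun x => ?_)
    simp only [map_add, map_smul, hRa]
    congr 1
    abel
  have := sq_deriv_integral_shift_le hfm hf2' a hD'
  rw [hna] at this
  rw [hint m hf, hint m (by fun_prop)]
  exact this

end Multivariate

/-! ### Empirical second moments of the pilots -/

section Pilots

variable {Ω ι : Type*} [Fintype ι] [MeasurableSpace Ω] {P : Measure Ω}

/-- The strong law of large numbers for the sample covariance of i.i.d. complex vectors whose
coordinates have finite and positive second moments. -/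
lemma ae_tendsto_sample_covariance (X : ℕ → Ω → ι → ℂ)
    (hmeas : ∀ g, Measurable (X g)) (hindep : iIndepFun X P)
    (hident : ∀ g, IdentDistrib (X g) (X 0) P P) (C : ι → ι → ℂ) (hC : ∀ i, C i i ≠ 0)
    (hcov : ∀ i j, ∫ ω, X 0 ω i * conj (X 0 ω j) ∂P = C i j) :
    ∀ᵐ ω ∂P, ∀ i j, Tendsto
      (fun G : ℕ => (G : ℝ)⁻¹ • ∑ g ∈ Finset.range G, X g ω i * conj (X g ω j)) atTop
      (𝓝 (C i j)) := by
  have hL2 : ∀ i, MemLp (fun ω => X 0 ω i) 2 P := by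
    intro i
    have hm : Measurable fun ω => X 0 ω i := (measurable_pi_apply i).comp (hmeas 0)
    -- a non-integrable square would have integral zero, but the second moment is not zero
    have hint : Integrable (fun ω => X 0 ω i * conj (X 0 ω i)) P := by
      by_contra hn
      exact hC i (by rw [← hcov i i, integral_undef hn])
    rw [memLp_two_iff_integrable_sq_norm hm.aestronglyMeasurable]
    refine hint.norm.congr (ae_of_all _ fun ω => ?_)
    simp [sq]
  have hφ : ∀ i j, Measurable fun x : ι → ℂ => x i * conj (x j) := fun i j => by fun_prop
  refine ae_all_iff.2 fun i => ae_all_iff.2 fun j => ?_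
  have h := strong_law_ae (μ := P) (fun g ω => X g ω i * conj (X g ω j))
    ((hL2 i).integrable_mul (hL2 j).star)
    (fun g g' hg => (hindep.indepFun hg).comp (hφ i j) (hφ i j))
    (fun g => (hident g).comp (hφ i j))
  rw [hcov i j] at h
  exact h

end Pilots

/-! ### The Fisher information matrix -/

namespace SpoofModel

variable {K N Nt : ℕ} (M : SpoofModel K N Nt)

/-- The unimodular factor `exp(-j 2π n τ̄ₖ / (N Tₛ)) conj(α(θ̄ₖ)ₘ)` of path `k` on
sub-carrier `n` and antenna `m`. -/
def pathPhase (n : Fin N) (m : Fin Nt) (k : Fin (K + 1)) : ℂ :=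
  Complex.exp (-Complex.I * ((2 * Real.pi * (n : ℕ) * M.toaBar k / (N * M.Ts) : ℝ) : ℂ)) *
    conj (M.steering (M.aodBar k) m)

/-- The factor which multiplies `pathPhase` in the derivative of the channel with respect to a
parameter. -/
def paramWeight (n : Fin N) (m : Fin Nt) : XiIdx K → ℂ
  | Sum.inl i => ![-Complex.I * ((2 * Real.pi / (N * M.Ts) * (n : ℕ) : ℝ) : ℂ) * M.γ i.2,
      Complex.I * ((2 * Real.pi * M.d * Real.cos (M.aodBar i.2) / M.lam * (m : ℕ) : ℝ) : ℂ)
        * M.γ i.2] i.1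
  | Sum.inr i => ![1, Complex.I] i.1

/-- The derivative of the channel with respect to a parameter. -/
def channelDeriv (n : Fin N) (i : XiIdx K) (m : Fin Nt) : ℂ :=
  M.pathPhase n m (pathOf i) * M.paramWeight n m i

lemma conj_steering (θ : ℝ) (m : Fin Nt) : conj (M.steering θ m)
    = Complex.exp (Complex.I * ((2 * Real.pi * (m : ℕ) * M.d * Real.sin θ / M.lam : ℝ) : ℂ)) := by
  rw [steering, ← Complex.exp_conj]
  simp only [map_mul, map_neg, Complex.conj_I, Complex.conj_ofReal, neg_neg]

lemma norm_pathPhase (n : Fin N) (m : Fin Nt) (k : Fin (K + 1)) : ‖M.pathPhase n m k‖ = 1 := by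
  rw [pathPhase, conj_steering, norm_mul, mul_comm Complex.I, Complex.norm_exp_ofReal_mul_I,
    neg_mul, ← mul_neg, mul_comm Complex.I, ← Complex.ofReal_neg, Complex.norm_exp_ofReal_mul_I,
    one_mul]

lemma hasDerivAt_channel (n : Fin N) (i : XiIdx K) (m : Fin Nt) :
    HasDerivAt (fun t : ℝ => M.channel n (Function.update M.xiBar i t) m)
      (M.channelDeriv n i m) (M.xiBar i) := by
  have hsum : M.channelDeriv n i m
      = ∑ k, if k = pathOf i then M.channelDeriv n i m else 0 := by simp
  rw [hsum]
  unfold channel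
  refine HasDerivAt.fun_sum fun k _ => ?_
  by_cases hk : k = pathOf i
  swap
  · rw [if_neg hk]
    have h0 : ∀ a, i ≠ Sum.inl (a, k) := fun a h => hk (by rw [h]; rfl)
    have h1 : ∀ a, i ≠ Sum.inr (a, k) := fun a h => hk (by rw [h]; rfl)
    simp only [Function.update_of_ne (h0 _).symm, Function.update_of_ne (h1 _).symm]
    exact hasDerivAt_const _ _
  rw [if_pos hk]
  simp only [conj_steering]
  have hid : ∀ x : ℝ, HasDerivAt (fun t : ℝ => (t : ℂ)) 1 x := fun x => Complex.ofRealCLM.hasDerivAt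
  have hγk : ((M.γ k).re : ℂ) + Complex.I * ((M.γ k).im : ℂ) = M.γ k := by
    rw [mul_comm]; exact Complex.re_add_im _
  rcases i with ⟨a, l⟩ | ⟨a, l⟩ <;> obtain rfl : k = l := hk <;> fin_cases a
  · have h : HasDerivAt (fun t : ℝ => ((2 * Real.pi * (n : ℕ) * t / (N * M.Ts) : ℝ) : ℂ))
        ((2 * Real.pi / (N * M.Ts) * (n : ℕ) : ℝ) : ℂ) (M.toaBar k) := by
      have := (((hasDerivAt_id (M.toaBar k)).const_mul
        (2 * Real.pi * (n : ℕ))).div_const (N * M.Ts)).ofReal_comp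
      refine this.congr_deriv ?_
      push_cast; ring
    have := (((h.const_mul (-Complex.I)).cexp.const_mul (M.γ k))).mul_const
      (conj (M.steering (M.aodBar k) m))
    simp only [conj_steering] at this
    simp only [xiBar, etaBar, channelDeriv, pathPhase, pathOf, paramWeight, conj_steering, hγk,
      Function.update_apply, reduceCtorEq, Sum.inl.injEq, Prod.mk.injEq, if_false, and_true,
      Fin.isValue, Fin.zero_eta, if_true, one_ne_zero, Matrix.cons_val_zero,
      Matrix.cons_val_one]
    refine this.congr_deriv ?_
    ring
  · have h : HasDerivAt (fun t : ℝ =>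
        ((2 * Real.pi * (m : ℕ) * M.d * Real.sin t / M.lam : ℝ) : ℂ))
        ((2 * Real.pi * M.d * Real.cos (M.aodBar k) / M.lam * (m : ℕ) : ℝ) : ℂ)
        (M.aodBar k) := by
      have := (((Real.hasDerivAt_sin (M.aodBar k)).const_mul
        (2 * Real.pi * (m : ℕ) * M.d)).div_const M.lam).ofReal_comp
      refine this.congr_deriv ?_
      push_cast; ring
    have := (h.const_mul Complex.I).cexp.const_mul (M.γ k *
      Complex.exp (-Complex.I * ((2 * Real.pi * (n : ℕ) * M.toaBar k / (N * M.Ts) : ℝ) : ℂ)))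
    simp only [xiBar, etaBar, channelDeriv, pathPhase, pathOf, paramWeight, conj_steering, hγk,
      Function.update_apply, reduceCtorEq, Sum.inl.injEq, Prod.mk.injEq, if_false, and_true,
      Fin.isValue, Fin.mk_one, if_true, zero_ne_one, Matrix.cons_val_zero,
      Matrix.cons_val_one]
    refine this.congr_deriv ?_
    ring
  · have := (((hid (M.γ k).re).add_const (Complex.I * ((M.γ k).im : ℂ))).mul_const
      (Complex.exp (-Complex.I * ((2 * Real.pi * (n : ℕ) * M.toaBar k / (N * M.Ts) : ℝ) : ℂ))
        )).mul_const (conj (M.steering (M.aodBar k) m))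
    simp only [conj_steering] at this
    simp only [xiBar, etaBar, channelDeriv, pathPhase, pathOf, paramWeight, conj_steering,
      Function.update_apply, reduceCtorEq, Sum.inr.injEq, Prod.mk.injEq, if_false, and_true,
      Fin.isValue, Fin.zero_eta, if_true, one_ne_zero, Matrix.cons_val_zero,
      Matrix.cons_val_one]
    refine this.congr_deriv ?_
    ring
  · have := ((((hid (M.γ k).im).const_mul Complex.I).const_add ((M.γ k).re : ℂ)).mul_const
      (Complex.exp (-Complex.I * ((2 * Real.pi * (n : ℕ) * M.toaBar k / (N * M.Ts) : ℝ) : ℂ))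
        )).mul_const (conj (M.steering (M.aodBar k) m))
    simp only [conj_steering] at this
    simp only [xiBar, etaBar, channelDeriv, pathPhase, pathOf, paramWeight, conj_steering,
      Function.update_apply, reduceCtorEq, Sum.inr.injEq, Prod.mk.injEq, if_false, and_true,
      Fin.isValue, Fin.mk_one, if_true, zero_ne_one, Matrix.cons_val_zero,
      Matrix.cons_val_one]
    refine this.congr_deriv ?_
    ring

lemma dsignal_eq (n : Fin N) (s : Fin Nt → ℂ) (i : XiIdx K) :
    M.dsignal n s i = ∑ m, M.channelDeriv n i m * s m := by
  refine HasDerivAt.deriv ?_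
  exact HasDerivAt.fun_sum fun m _ => (M.hasDerivAt_channel n i m).mul_const (s m)

/-- The Fisher information per pilot for pilots whose sample covariance is exactly `I / Nₜ`. -/
def limitFim : Matrix (XiIdx K) (XiIdx K) ℝ :=
  Matrix.of fun i j => 2 / M.σ ^ 2 *
    ∑ n : Fin N, ∑ m : Fin Nt, (conj (M.channelDeriv n i m) * M.channelDeriv n j m).re / Nt

lemma tendsto_fim {s : ℕ → Fin N → Fin Nt → ℂ}
    (hs : ∀ n m m', Tendsto
      (fun G : ℕ => (G : ℝ)⁻¹ • ∑ g ∈ Finset.range G, s g n m * conj (s g n m')) atTop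
      (𝓝 (if m = m' then (1 / Nt : ℂ) else 0))) :
    Tendsto (fun G : ℕ => (G : ℝ)⁻¹ • M.fim s G) atTop (𝓝 M.limitFim) := by
  refine tendsto_pi_nhds.2 fun i => tendsto_pi_nhds.2 fun j => ?_
  have key : ∀ n, Tendsto (fun G : ℕ => ∑ m, ∑ m',
      (conj (M.channelDeriv n i m) * M.channelDeriv n j m' *
        ((G : ℝ)⁻¹ • ∑ g ∈ Finset.range G, s g n m' * conj (s g n m)))) atTop
      (𝓝 (∑ m, ∑ m', conj (M.channelDeriv n i m) * M.channelDeriv n j m' *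
        (if m' = m then (1 / Nt : ℂ) else 0))) := fun n =>
    tendsto_finsetSum _ fun m _ => tendsto_finsetSum _ fun m' _ => (hs n m' m).const_mul _
  have := (tendsto_finsetSum Finset.univ fun n _ =>
    (Complex.continuous_re.tendsto _).comp (key n)).const_mul (2 / M.σ ^ 2)
  refine (this.congr fun G => ?_).trans_eq ?_
  · simp only [fim, Matrix.smul_apply, Matrix.of_apply, smul_eq_mul, Function.comp]
    rw [mul_left_comm]
    congr 1
    rw [Finset.mul_sum]
    refine Finset.sum_congr rfl fun n _ => ?_
    have e : ∀ g, conj (M.dsignal n (s g n) i) * M.dsignal n (s g n) j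
        = ∑ m, ∑ m', conj (M.channelDeriv n i m) * M.channelDeriv n j m' *
          (s g n m' * conj (s g n m)) := by
      intro g
      simp only [dsignal_eq, map_sum, map_mul, Finset.sum_mul_sum]
      exact Finset.sum_congr rfl fun m _ => Finset.sum_congr rfl fun m' _ => by ring
    rw [← Complex.re_sum, ← Complex.re_ofReal_mul]
    congr 1
    simp only [e, Complex.real_smul, Finset.mul_sum]
    conv_rhs => rw [Finset.sum_comm]
    refine Finset.sum_congr rfl fun m _ => ?_
    conv_rhs => rw [Finset.sum_comm]
    refine Finset.sum_congr rfl fun m' _ => Finset.sum_congr rfl fun g _ => ?_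
    push_cast; ring
  · simp only [limitFim, Matrix.of_apply, Complex.re_sum, mul_ite, mul_zero, Finset.sum_ite_eq',
      Finset.mem_univ, if_true]
    congr 2
    refine (Finset.sum_congr rfl fun n _ => Finset.sum_congr rfl fun m _ => ?_)
    rw [mul_one_div, ← Complex.ofReal_natCast, Complex.div_ofReal_re]

end SpoofModel

/-! ### The effective information matrix of the limit -/

section EffectiveInformation

variable {m n : Type*} [Fintype n] [DecidableEq n]

/-- The effective information matrix for the first block of parameters: the Schur complement of
the second diagonal block. -/
def schurCompl (A : Matrix (m ⊕ n) (m ⊕ n) ℝ) : Matrix m m ℝ :=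
  A.toBlocks₁₁ - A.toBlocks₁₂ * A.toBlocks₂₂⁻¹ * A.toBlocks₂₁

lemma inv_smul_of_ne_zero {r : ℝ} (hr : r ≠ 0) (A : Matrix n n ℝ) : (r • A)⁻¹ = r⁻¹ • A⁻¹ := by
  by_cases hA : IsUnit A.det
  · exact Matrix.inv_smul' A (Units.mk0 r hr) hA
  · rw [Matrix.nonsing_inv_apply_not_isUnit _ hA, Matrix.nonsing_inv_apply_not_isUnit, smul_zero]
    rwa [Matrix.det_smul, IsUnit.mul_iff, not_and_or, or_iff_right]
    exact not_not.2 (pow_ne_zero _ hr).isUnit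

lemma schurCompl_smul {r : ℝ} (hr : r ≠ 0) (A : Matrix (m ⊕ n) (m ⊕ n) ℝ) :
    schurCompl (r • A) = r • schurCompl A := by
  have h11 : (r • A).toBlocks₁₁ = r • A.toBlocks₁₁ := rfl
  have h12 : (r • A).toBlocks₁₂ = r • A.toBlocks₁₂ := rfl
  have h21 : (r • A).toBlocks₂₁ = r • A.toBlocks₂₁ := rfl
  have h22 : (r • A).toBlocks₂₂⁻¹ = r⁻¹ • A.toBlocks₂₂⁻¹ := inv_smul_of_ne_zero hr _
  simp only [schurCompl, h11, h12, h21, h22, smul_sub, Matrix.smul_mul, Matrix.mul_smul,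
    smul_smul, inv_mul_cancel₀ hr, one_smul]

lemma continuousAt_schurCompl {A : Matrix (m ⊕ n) (m ⊕ n) ℝ} (hA : A.toBlocks₂₂.det ≠ 0) :
    ContinuousAt schurCompl A := by
  have hinv : ContinuousAt (fun B : Matrix (m ⊕ n) (m ⊕ n) ℝ => B.toBlocks₂₂⁻¹) A := by
    refine ContinuousAt.comp (g := fun C : Matrix n n ℝ => C⁻¹)
      (continuousAt_matrix_inv _ ?_) (continuous_id.matrix_submatrix Sum.inr Sum.inr).continuousAt
    rw [Ring.inverse_eq_inv']
    exact continuousAt_inv₀ hA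
  unfold schurCompl
  have c11 : ContinuousAt (fun B : Matrix (m ⊕ n) (m ⊕ n) ℝ => B.toBlocks₁₁) A :=
    (continuous_id.matrix_submatrix Sum.inl Sum.inl).continuousAt
  have c12 : ContinuousAt (fun B : Matrix (m ⊕ n) (m ⊕ n) ℝ => B.toBlocks₁₂) A :=
    (continuous_id.matrix_submatrix Sum.inl Sum.inr).continuousAt
  have c21 : ContinuousAt (fun B : Matrix (m ⊕ n) (m ⊕ n) ℝ => B.toBlocks₂₁) A :=
    (continuous_id.matrix_submatrix Sum.inr Sum.inl).continuousAt
  have hmul : Continuous fun p : Matrix m n ℝ × Matrix n n ℝ × Matrix n m ℝ =>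
      p.1 * p.2.1 * p.2.2 := by fun_prop
  exact c11.sub (ContinuousAt.comp (g := fun p : Matrix m n ℝ × Matrix n n ℝ × Matrix n m ℝ =>
      p.1 * p.2.1 * p.2.2)
    (f := fun B : Matrix (m ⊕ n) (m ⊕ n) ℝ => (B.toBlocks₁₂, B.toBlocks₂₂⁻¹, B.toBlocks₂₁))
    hmul.continuousAt (c12.prodMk (hinv.prodMk c21)))

lemma schurCompl_posSemidef [Fintype m] {A : Matrix (m ⊕ n) (m ⊕ n) ℝ} (hA : A.PosSemidef)
    (hdet : A.toBlocks₂₂.det ≠ 0) : (schurCompl A).PosSemidef := by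
  have h22 : A.toBlocks₂₂.PosDef :=
    (hA.submatrix Sum.inr : A.toBlocks₂₂.PosSemidef).posDef_iff_det_ne_zero.2 hdet
  have h21 : A.toBlocks₂₁ = A.toBlocks₁₂ᴴ := by
    ext i j
    exact (hA.isHermitian.apply (Sum.inr i) (Sum.inl j)).symm
  have := h22.isUnit.invertible
  rw [schurCompl, h21]
  rw [← Matrix.PosDef.fromBlocks₂₂ _ _ h22, ← h21, Matrix.fromBlocks_toBlocks]
  exact hA

end EffectiveInformation

namespace SpoofModel

variable {K N Nt : ℕ} (M : SpoofModel K N Nt)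

lemma effFim_eq (s : ℕ → Fin N → Fin Nt → ℂ) (G : ℕ) :
    M.effFim s G = schurCompl (M.fim s G) := rfl

lemma posSemidef_fim (s : ℕ → Fin N → Fin Nt → ℂ) (G : ℕ) : (M.fim s G).PosSemidef := by
  refine Matrix.PosSemidef.of_dotProduct_mulVec_nonneg ?_ fun x => ?_
  · ext i j
    simp only [fim, Matrix.conjTranspose_apply, Matrix.of_apply, star_trivial]
    congr 1
    refine Finset.sum_congr rfl fun n _ => Finset.sum_congr rfl fun g _ => ?_
    simp [mul_comm]
  · have h : star x ⬝ᵥ (M.fim s G *ᵥ x) = 2 / M.σ ^ 2 *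
        ∑ n : Fin N, ∑ g ∈ Finset.range G, ‖∑ i, (x i : ℂ) * M.dsignal n (s g n) i‖ ^ 2 := by
      have e : ∀ n g, ‖∑ i, (x i : ℂ) * M.dsignal n (s g n) i‖ ^ 2
          = ∑ i, ∑ j, x i * x j * (conj (M.dsignal n (s g n) i) * M.dsignal n (s g n) j).re := by
        intro n g
        have := Complex.conj_mul' (∑ i, (x i : ℂ) * M.dsignal n (s g n) i)
        rw [map_sum, Finset.sum_mul_sum, ← Complex.ofReal_pow] at this
        have := congrArg Complex.re this
        rw [Complex.ofReal_re] at this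
        rw [← this, Complex.re_sum]
        refine Finset.sum_congr rfl fun i _ => ?_
        rw [Complex.re_sum]
        refine Finset.sum_congr rfl fun j _ => ?_
        rw [map_mul, Complex.conj_ofReal, mul_mul_mul_comm, ← Complex.ofReal_mul,
          Complex.re_ofReal_mul]
      simp only [e, dotProduct, Matrix.mulVec, fim, Matrix.of_apply, star_trivial, Finset.mul_sum,
        Finset.sum_mul]
      conv_rhs =>
        enter [2, n]
        rw [Finset.sum_comm]
      conv_rhs => rw [Finset.sum_comm]
      refine Finset.sum_congr rfl fun i _ => ?_
      conv_rhs =>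
        enter [2, n]
        rw [Finset.sum_comm]
      conv_rhs => rw [Finset.sum_comm]
      refine Finset.sum_congr rfl fun j _ => ?_
      refine Finset.sum_congr rfl fun n _ => Finset.sum_congr rfl fun g _ => ?_
      ring
    rw [h]
    positivity

/-- The diagonal of the effective Fisher information per pilot in the limit of many pilots. -/
def limitInfo (i : EtaIdx K) : ℝ :=
  ![2 / M.σ ^ 2 * (2 * Real.pi / (N * M.Ts)) ^ 2 * ‖M.γ i.2‖ ^ 2 * (N * (N ^ 2 - 1) / 12),
    2 / M.σ ^ 2 * (2 * Real.pi * M.d * Real.cos (M.aodBar i.2) / M.lam) ^ 2 * ‖M.γ i.2‖ ^ 2 *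
      (N * (Nt ^ 2 - 1) / 12)] i.1

lemma sum_fin_cast (n : ℕ) : ∑ i : Fin n, ((i : ℕ) : ℝ) = n * (n - 1) / 2 := by
  rw [Fin.sum_univ_eq_sum_range (fun i : ℕ => (i : ℝ)) n]
  induction n with
  | zero => simp
  | succ n ih => rw [Finset.sum_range_succ, ih]; push_cast; ring

lemma sum_fin_cast_sq (n : ℕ) :
    ∑ i : Fin n, ((i : ℕ) : ℝ) ^ 2 = n * (n - 1) * (2 * n - 1) / 6 := by
  rw [Fin.sum_univ_eq_sum_range (fun i : ℕ => (i : ℝ) ^ 2) n]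
  induction n with
  | zero => simp
  | succ n ih => rw [Finset.sum_range_succ, ih]; push_cast; ring

/-- Within one path, the phases cancel in the Fisher information. -/
lemma limitFim_of_pathOf_eq {i j : XiIdx K} (hij : pathOf i = pathOf j) :
    M.limitFim i j = 2 / M.σ ^ 2 *
      ∑ n : Fin N, ∑ m : Fin Nt, (conj (M.paramWeight n m i) * M.paramWeight n m j).re / Nt := by
  rw [limitFim, Matrix.of_apply]
  congr 1
  refine Finset.sum_congr rfl fun n _ => Finset.sum_congr rfl fun m _ => ?_
  rw [channelDeriv, channelDeriv, hij, map_mul, mul_mul_mul_comm, Complex.conj_mul',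
    norm_pathPhase]
  simp

lemma sum_sum_div_eq {f : Fin N → Fin Nt → ℝ} (c : ℝ) (a : Fin N → ℝ) (b : Fin Nt → ℝ)
    (hf : ∀ n m, f n m = c * a n * b m) :
    ∑ n, ∑ m, f n m / (Nt : ℝ) = c * (∑ n, a n) * (∑ m, b m) / Nt := by
  simp_rw [← Finset.sum_div, hf, mul_assoc, ← Finset.mul_sum, ← Finset.sum_mul]

/-- If the cross-path entries of the limiting information matrix vanish, its effective
information matrix is diagonal: within a path, the part of the delay score correlated with the
angle score lies along the path coefficient and is removed by the projection. -/
lemma schurCompl_limitFim (hN : N ≠ 0) (hNt : Nt ≠ 0) (hσ : M.σ ≠ 0)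
    (h : ∀ i j : XiIdx K, pathOf i ≠ pathOf j → M.limitFim i j = 0) :
    M.limitFim.toBlocks₂₂.det ≠ 0 ∧
      schurCompl M.limitFim = Matrix.diagonal M.limitInfo := by
  have hN' : (N : ℝ) ≠ 0 := by exact_mod_cast hN
  have hNt' : (Nt : ℝ) ≠ 0 := by exact_mod_cast hNt
  have h22 : M.limitFim.toBlocks₂₂ = (2 * N / M.σ ^ 2) • (1 : Matrix (EtaIdx K) (EtaIdx K) ℝ) := by
    ext ⟨a, k⟩ ⟨b, l⟩
    simp only [Matrix.toBlocks₂₂, Matrix.of_apply, Matrix.smul_apply, Matrix.one_apply,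
      smul_eq_mul]
    by_cases hkl : k = l
    swap
    · rw [h _ _ (by simpa [pathOf] using hkl), if_neg (by simp [hkl]), mul_zero]
    subst hkl
    rw [M.limitFim_of_pathOf_eq (i := Sum.inr (a, k)) (j := Sum.inr (b, k)) rfl]
    fin_cases a <;> fin_cases b <;> simp [paramWeight] <;> field_simp
  have hc : (2 * N / M.σ ^ 2 : ℝ) ≠ 0 := by positivity
  refine ⟨by rw [h22]; simp [hN, hσ], ?_⟩
  have hinv : M.limitFim.toBlocks₂₂⁻¹
      = (2 * N / M.σ ^ 2)⁻¹ • (1 : Matrix (EtaIdx K) (EtaIdx K) ℝ) := by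
    rw [h22, inv_smul_of_ne_zero hc, inv_one]
  rw [schurCompl, hinv, Matrix.mul_smul, Matrix.mul_one, Matrix.smul_mul]
  ext ⟨a, k⟩ ⟨b, l⟩
  simp only [Matrix.sub_apply, Matrix.smul_apply, Matrix.mul_apply, Matrix.toBlocks₁₁,
    Matrix.toBlocks₁₂, Matrix.toBlocks₂₁, Matrix.of_apply, smul_eq_mul, Fintype.sum_prod_type,
    Fin.sum_univ_two]
  have hs : ∀ a', ∑ k', M.limitFim (Sum.inl (a, k)) (Sum.inr (a', k')) *
        M.limitFim (Sum.inr (a', k')) (Sum.inl (b, l))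
      = M.limitFim (Sum.inl (a, k)) (Sum.inr (a', k)) *
        M.limitFim (Sum.inr (a', k)) (Sum.inl (b, l)) := by
    intro a'
    refine Finset.sum_eq_single k (fun k' _ hk' => ?_) (by simp)
    rw [h (Sum.inl (a, k)) (Sum.inr (a', k')) (by simpa [pathOf] using hk'.symm), zero_mul]
  rw [hs, hs]
  by_cases hkl : k = l
  swap
  · rw [h (Sum.inl (a, k)) (Sum.inl (b, l)) hkl, h (Sum.inr (0, k)) (Sum.inl (b, l)) hkl,
      h (Sum.inr (1, k)) (Sum.inl (b, l)) hkl, Matrix.diagonal_apply_ne _ (by simp [hkl])]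
    simp
  subst hkl
  set ω : ℝ := 2 * Real.pi / (N * M.Ts) with hω
  set κ : ℝ := 2 * Real.pi * M.d * Real.cos (M.aodBar k) / M.lam with hκ
  have hγ : ‖M.γ k‖ ^ 2 = (M.γ k).re ^ 2 + (M.γ k).im ^ 2 := by
    rw [Complex.sq_norm, Complex.normSq_apply]; ring
  set F : XiIdx K → XiIdx K → ℝ := fun i j =>
    ∑ n : Fin N, ∑ m : Fin Nt, (conj (M.paramWeight n m i) * M.paramWeight n m j).re / Nt with hF
  have hll : ∀ a b, M.limitFim (Sum.inl (a, k)) (Sum.inl (b, k))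
      = 2 / M.σ ^ 2 * F (Sum.inl (a, k)) (Sum.inl (b, k)) := fun _ _ => limitFim_of_pathOf_eq M rfl
  have hlr : ∀ a b, M.limitFim (Sum.inl (a, k)) (Sum.inr (b, k))
      = 2 / M.σ ^ 2 * F (Sum.inl (a, k)) (Sum.inr (b, k)) := fun _ _ => limitFim_of_pathOf_eq M rfl
  have hrl : ∀ a b, M.limitFim (Sum.inr (a, k)) (Sum.inl (b, k))
      = 2 / M.σ ^ 2 * F (Sum.inr (a, k)) (Sum.inl (b, k)) := fun _ _ => limitFim_of_pathOf_eq M rfl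
  simp only [hll, hlr, hrl]
  have hsymm : ∀ i j, F i j = F j i := by
    intro i j
    refine Finset.sum_congr rfl fun n _ => Finset.sum_congr rfl fun m _ => ?_
    simp only [Complex.mul_re, Complex.conj_re, Complex.conj_im]
    ring
  -- the entries of one path, from the first two power sums over sub-carriers and antennas
  have Fττ : F (Sum.inl (0, k)) (Sum.inl (0, k))
      = ω ^ 2 * ‖M.γ k‖ ^ 2 * (N * (N - 1) * (2 * N - 1) / 6) := by
    rw [hF]
    simp only
    rw [sum_sum_div_eq (ω ^ 2 * ‖M.γ k‖ ^ 2) (fun n => ((n : ℕ) : ℝ) ^ 2) (fun _ => 1) ?_,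
      sum_fin_cast_sq]
    · simp; field_simp
    · intro n m
      rw [hγ]
      simp [paramWeight, ← hω]
      ring
  have Fτθ : F (Sum.inl (0, k)) (Sum.inl (1, k))
      = -(ω * κ * ‖M.γ k‖ ^ 2) * (N * (N - 1) / 2) * (Nt * (Nt - 1) / 2) / Nt := by
    rw [hF]
    simp only
    rw [sum_sum_div_eq (-(ω * κ * ‖M.γ k‖ ^ 2)) (fun n => ((n : ℕ) : ℝ))
      (fun m => ((m : ℕ) : ℝ)) ?_, sum_fin_cast, sum_fin_cast]
    intro n m
    rw [hγ]
    simp [paramWeight, ← hω, ← hκ]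
    ring
  have Fθθ : F (Sum.inl (1, k)) (Sum.inl (1, k))
      = κ ^ 2 * ‖M.γ k‖ ^ 2 * N * (Nt * (Nt - 1) * (2 * Nt - 1) / 6) / Nt := by
    rw [hF]
    simp only
    rw [sum_sum_div_eq (κ ^ 2 * ‖M.γ k‖ ^ 2) (fun _ => 1) (fun m => ((m : ℕ) : ℝ) ^ 2) ?_,
      sum_fin_cast_sq]
    · simp
    · intro n m
      rw [hγ]
      simp [paramWeight, ← hκ]
      ring
  have Fτx : F (Sum.inl (0, k)) (Sum.inr (0, k)) = ω * (M.γ k).im * (N * (N - 1) / 2) := by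
    rw [hF]
    simp only
    rw [sum_sum_div_eq (ω * (M.γ k).im) (fun n => ((n : ℕ) : ℝ)) (fun _ => 1) ?_, sum_fin_cast]
    · simp; field_simp
    · intro n m
      simp [paramWeight, ← hω]
      ring
  have Fτy : F (Sum.inl (0, k)) (Sum.inr (1, k)) = -(ω * (M.γ k).re) * (N * (N - 1) / 2) := by
    rw [hF]
    simp only
    rw [sum_sum_div_eq (-(ω * (M.γ k).re)) (fun n => ((n : ℕ) : ℝ)) (fun _ => 1) ?_, sum_fin_cast]
    · simp; field_simp
    · intro n m
      simp [paramWeight, ← hω]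
      ring
  have Fθx : F (Sum.inl (1, k)) (Sum.inr (0, k))
      = -(κ * (M.γ k).im) * N * (Nt * (Nt - 1) / 2) / Nt := by
    rw [hF]
    simp only
    rw [sum_sum_div_eq (-(κ * (M.γ k).im)) (fun _ => 1) (fun m => ((m : ℕ) : ℝ)) ?_, sum_fin_cast]
    · simp
    · intro n m
      simp [paramWeight, ← hκ]
      ring
  have Fθy : F (Sum.inl (1, k)) (Sum.inr (1, k))
      = κ * (M.γ k).re * N * (Nt * (Nt - 1) / 2) / Nt := by
    rw [hF]
    simp only
    rw [sum_sum_div_eq (κ * (M.γ k).re) (fun _ => 1) (fun m => ((m : ℕ) : ℝ)) ?_, sum_fin_cast]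
    · simp
    · intro n m
      simp [paramWeight, ← hκ]
      ring
  fin_cases a <;> fin_cases b <;>
    simp only [Fin.zero_eta, Fin.mk_one, Fin.isValue]
  · rw [Matrix.diagonal_apply_eq, hsymm (Sum.inr _), hsymm (Sum.inr _), Fττ, Fτx, Fτy]
    simp only [limitInfo, Matrix.cons_val_zero, ← hω, hγ]
    field_simp
    ring
  · rw [Matrix.diagonal_apply_ne _ (by simp), hsymm (Sum.inr _), hsymm (Sum.inr _), Fτθ, Fτx, Fτy,
      Fθx, Fθy, hγ]
    field_simp
    ring
  · rw [Matrix.diagonal_apply_ne _ (by simp), hsymm (Sum.inl (1, k)) (Sum.inl (0, k)),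
      hsymm (Sum.inr _), hsymm (Sum.inr _), Fτθ, Fτx, Fτy, Fθx, Fθy, hγ]
    field_simp
    ring
  · rw [Matrix.diagonal_apply_eq, hsymm (Sum.inr _), hsymm (Sum.inr _), Fθθ, Fθx, Fθy]
    simp only [limitInfo, Matrix.cons_val_one, Matrix.cons_val_zero, ← hκ, hγ]
    field_simp
    ring

end SpoofModel

/-! ### The bound for a fixed number of pilots -/

namespace SpoofModel

open scoped RealInnerProductSpace

variable {K N Nt : ℕ} (M : SpoofModel K N Nt)

lemma inner_plane (a b : ℝ) (x : Plane) : ⟪!₂[a, b], x⟫ = a * x 0 + b * x 1 := by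
  simp [PiLp.inner_apply, Fin.sum_univ_two]
  ring

lemma norm_sq_eq_rotated (θ : ℝ) (x : Plane) :
    ‖x‖ ^ 2 = ⟪!₂[Real.cos θ, Real.sin θ], x⟫ ^ 2 + ⟪!₂[-Real.sin θ, Real.cos θ], x⟫ ^ 2 := by
  rw [inner_plane, inner_plane, EuclideanSpace.real_norm_sq_eq, Fin.sum_univ_two]
  linear_combination -(x 0 ^ 2 + x 1 ^ 2) * Real.sin_sq_add_cos_sq θ

/-- The Cramér–Rao inequality for one linear functional of a misspecified-unbiased estimator and
one channel parameter. -/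
lemma sq_deriv_le_of_MSUnbiased {s : ℕ → Fin N → Fin Nt → ℂ} {G : ℕ} {k : Fin (K + 1)}
    {phat : EuclideanSpace ℝ (EtaIdx K) → Plane} (hJ : (M.effFim s G).PosDef)
    (hphat : Measurable phat) (hub : M.MSUnbiased s G k phat)
    (h2 : MemLp phat 2 (M.estLaw s G M.etaBar)) (e : Plane) (i : EtaIdx K) {D : ℝ}
    (hD : HasDerivAt (fun t : ℝ =>
      ⟪e, M.pseudoPos k (M.etaBar + t • EuclideanSpace.single i (1 : ℝ))⟫) D 0) :
    D ^ 2 / M.effFim s G i i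
      ≤ ∫ x, ⟪e, phat x - M.pseudoPos k M.etaBar⟫ ^ 2 ∂(M.estLaw s G M.etaBar) := by
  have hmean : ∀ η, Integrable phat (M.estLaw s G η) →
      ∫ x, phat x ∂(M.estLaw s G η) = M.pseudoPos k η →
      ∫ x, ⟪e, phat x⟫ ∂(M.estLaw s G η) = ⟪e, M.pseudoPos k η⟫ := fun η hi hη => by
    rw [integral_inner hi, hη]
  have htend : Tendsto (fun t : ℝ => M.etaBar + t • EuclideanSpace.single i (1 : ℝ)) (𝓝 0)
      (𝓝 M.etaBar) := by
    have : Continuous fun t : ℝ => M.etaBar + t • EuclideanSpace.single i (1 : ℝ) := by fun_prop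
    simpa using this.tendsto 0
  have hD' : HasDerivAt (fun t : ℝ => ∫ x, ⟪e, phat x⟫
      ∂(M.estLaw s G (M.etaBar + t • EuclideanSpace.single i (1 : ℝ)))) D 0 := by
    refine hD.congr_of_eventuallyEq ?_
    filter_upwards [htend.eventually hub] with t ht using hmean _ ht.1 ht.2
  have h := sq_deriv_integral_multivariateGaussian_le hJ M.etaBar i
    (f := fun x => ⟪e, phat x⟫) (by fun_prop) (h2.const_inner e) hD'
  rw [div_le_iff₀' hJ.diag_pos]
  refine h.trans_eq ?_
  congr 1
  refine integral_congr_ae (ae_of_all _ fun x => ?_)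
  have h0 := hub.self_of_nhds
  simp only
  rw [inner_sub_right]
  congr 2
  exact hmean _ h0.1 h0.2

/-- The misspecified Cramér–Rao bound. The two columns of the Jacobian of the pseudo-true position
are orthogonal, so that the radial error is controlled by the delay and the tangential error by
the angle. -/
lemma le_mse {s : ℕ → Fin N → Fin Nt → ℂ} {G : ℕ} {k : Fin (K + 1)}
    {phat : EuclideanSpace ℝ (EtaIdx K) → Plane} (hJ : (M.effFim s G).PosDef)
    (hphat : Measurable phat) (hub : M.MSUnbiased s G k phat) :
    ENNReal.ofReal (M.c ^ 2 / M.effFim s G (0, k) (0, k)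
        + (M.c * M.toaBar k) ^ 2 / M.effFim s G (1, k) (1, k)
        + ‖M.pseudoPos k M.etaBar - M.p‖ ^ 2) ≤ M.mse s G phat := by
  set μ := M.estLaw s G M.etaBar with hμ
  have : IsProbabilityMeasure μ := by rw [hμ, estLaw]; infer_instance
  set q := M.pseudoPos k M.etaBar with hq
  have h0 := hub.self_of_nhds
  rw [← hμ, ← hq] at h0
  by_cases hfin : M.mse s G phat = ∞
  · rw [hfin]; exact le_top
  have hi2 : Integrable (fun x => ‖phat x - M.p‖ ^ 2) μ := by
    refine ⟨by fun_prop, ?_⟩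
    rw [hasFiniteIntegral_iff_ofReal (ae_of_all _ fun x => by positivity)]
    exact lt_top_iff_ne_top.2 hfin
  have h2' : MemLp (fun x => phat x - M.p) 2 μ :=
    (memLp_two_iff_integrable_sq_norm (by fun_prop)).2 hi2
  have h2 : MemLp phat 2 μ := by
    have h := h2'.add (memLp_const M.p)
    have e : (fun x => phat x - M.p) + (fun _ => M.p) = phat := by
      ext1 x; exact sub_add_cancel _ _
    rwa [e] at h
  have h2q : MemLp (fun x => phat x - q) 2 μ := h2.sub (memLp_const q)
  set θ := M.aodBar k with hθ
  have hpos : ∀ η : EuclideanSpace ℝ (EtaIdx K), ∀ a b : ℝ, ⟪!₂[a, b], M.pseudoPos k η⟫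
      = ⟪!₂[a, b], M.z⟫
        - M.c * η (0, k) * (a * Real.cos (η (1, k)) + b * Real.sin (η (1, k))) := by
    intro η a b
    rw [pseudoPos, inner_sub_right, real_inner_smul_right, inner_plane _ _ !₂[_, _]]
    simp
  have hr : M.c ^ 2 / M.effFim s G (0, k) (0, k)
      ≤ ∫ x, ⟪!₂[Real.cos θ, Real.sin θ], phat x - q⟫ ^ 2 ∂μ := by
    have := M.sq_deriv_le_of_MSUnbiased hJ hphat hub h2 !₂[Real.cos θ, Real.sin θ] (0, k)
      (D := -M.c) ?_
    · simpa using this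
    have hd : HasDerivAt (fun t : ℝ => ⟪!₂[Real.cos θ, Real.sin θ], M.z⟫
        - M.c * (M.toaBar k + t)) (-M.c) 0 := by
      have := (((hasDerivAt_id (0 : ℝ)).const_add (M.toaBar k)).const_mul M.c).const_sub
        ⟪!₂[Real.cos θ, Real.sin θ], M.z⟫
      simpa using this
    refine hd.congr_of_eventuallyEq (Eventually.of_forall fun t => ?_)
    simp only [hpos]
    simp [etaBar, ← hθ, ← sq]
  have ht : (M.c * M.toaBar k) ^ 2 / M.effFim s G (1, k) (1, k)
      ≤ ∫ x, ⟪!₂[-Real.sin θ, Real.cos θ], phat x - q⟫ ^ 2 ∂μ := by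
    have := M.sq_deriv_le_of_MSUnbiased hJ hphat hub h2 !₂[-Real.sin θ, Real.cos θ] (1, k)
      (D := -(M.c * M.toaBar k)) ?_
    · simpa using this
    have hd : HasDerivAt (fun t : ℝ => ⟪!₂[-Real.sin θ, Real.cos θ], M.z⟫
        - M.c * M.toaBar k * (-Real.sin θ * Real.cos (θ + t) + Real.cos θ * Real.sin (θ + t)))
        (-(M.c * M.toaBar k)) 0 := by
      have hid := (hasDerivAt_id (0 : ℝ)).const_add θ
      have := (((hid.cos.const_mul (-Real.sin θ)).add (hid.sin.const_mul (Real.cos θ))).const_mul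
        (M.c * M.toaBar k)).const_sub ⟪!₂[-Real.sin θ, Real.cos θ], M.z⟫
      refine this.congr_deriv ?_
      simp only [id, add_zero]
      linear_combination -(M.c * M.toaBar k) * Real.sin_sq_add_cos_sq θ
    refine hd.congr_of_eventuallyEq (Eventually.of_forall fun t => ?_)
    simp only [hpos]
    simp [etaBar, ← hθ]
  have hir : Integrable (fun x => ⟪!₂[Real.cos θ, Real.sin θ], phat x - q⟫ ^ 2) μ :=
    (h2q.const_inner _).integrable_sq
  have hit : Integrable (fun x => ⟪!₂[-Real.sin θ, Real.cos θ], phat x - q⟫ ^ 2) μ :=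
    (h2q.const_inner _).integrable_sq
  have hdecomp : ∫ x, ‖phat x - M.p‖ ^ 2 ∂μ
      = ∫ x, ⟪!₂[Real.cos θ, Real.sin θ], phat x - q⟫ ^ 2 ∂μ
        + ∫ x, ⟪!₂[-Real.sin θ, Real.cos θ], phat x - q⟫ ^ 2 ∂μ + ‖q - M.p‖ ^ 2 := by
    -- the error splits into radial part, tangential part and bias; the cross term has mean zero
    have e : ∀ x, ‖phat x - M.p‖ ^ 2 = ⟪!₂[Real.cos θ, Real.sin θ], phat x - q⟫ ^ 2
        + ⟪!₂[-Real.sin θ, Real.cos θ], phat x - q⟫ ^ 2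
        + (2 * ⟪q - M.p, phat x - q⟫ + ‖q - M.p‖ ^ 2) := by
      intro x
      rw [← norm_sq_eq_rotated, ← sub_add_sub_cancel (phat x) q M.p, norm_add_sq_real,
        real_inner_comm]
      ring
    have hiq : Integrable (fun x => phat x - q) μ := h2q.integrable one_le_two
    have hil : Integrable (fun x => 2 * ⟪q - M.p, phat x - q⟫) μ :=
      (hiq.const_inner (q - M.p)).const_mul 2
    have hz : ∫ x, ⟪q - M.p, phat x - q⟫ ∂μ = 0 := by
      rw [integral_inner hiq, integral_sub h0.1 (integrable_const q), h0.2]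
      simp
    have i1 : Integrable (fun x => ⟪!₂[Real.cos θ, Real.sin θ], phat x - q⟫ ^ 2
        + ⟪!₂[-Real.sin θ, Real.cos θ], phat x - q⟫ ^ 2) μ := hir.add hit
    have i2 : Integrable (fun x => 2 * ⟪q - M.p, phat x - q⟫ + ‖q - M.p‖ ^ 2) μ :=
      hil.add (integrable_const _)
    simp_rw [e]
    rw [integral_add i1 i2, integral_add hir hit, integral_add hil (integrable_const _),
      integral_const_mul, hz]
    simp
  rw [mse, ← hμ, ← ofReal_integral_eq_lintegral_ofReal hi2 (ae_of_all _ fun x => by positivity),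
    hdecomp]
  exact ENNReal.ofReal_le_ofReal (by gcongr)

/-! ### Many pilots -/

lemma limitInfo_pos (hN : 2 ≤ N) (hNt : 2 ≤ Nt) (hlam : 0 < M.lam) (hd : M.d ≠ 0)
    (hTs : 0 < M.Ts) (hσ : 0 < M.σ) (hγ : ∀ k, M.γ k ≠ 0) (hcos : ∀ k, Real.cos (M.aodBar k) ≠ 0)
    (i : EtaIdx K) : 0 < M.limitInfo i := by
  have hN' : (2 : ℝ) ≤ N := by exact_mod_cast hN
  have hNt' : (2 : ℝ) ≤ Nt := by exact_mod_cast hNt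
  have h1 : (0 : ℝ) < (N : ℝ) ^ 2 - 1 := by nlinarith
  have h2 : (0 : ℝ) < (Nt : ℝ) ^ 2 - 1 := by nlinarith
  have h3 := norm_pos_iff.2 (hγ i.2)
  have h4 := hcos i.2
  obtain ⟨a, k⟩ := i
  have hπ := Real.pi_pos
  fin_cases a
  · simp only [limitInfo, Fin.zero_eta, Matrix.cons_val_zero]
    positivity
  · simp only [limitInfo, Fin.mk_one, Matrix.cons_val_one, Matrix.cons_val_zero]
    positivity

/-- The effective information for orthogonal limiting paths grows linearly in the number of
pilots, and is eventually invertible. -/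
lemma tendsto_effFim {s : ℕ → Fin N → Fin Nt → ℂ}
    (hs : Tendsto (fun G : ℕ => (G : ℝ)⁻¹ • M.fim s G) atTop (𝓝 M.limitFim))
    (hdet : M.limitFim.toBlocks₂₂.det ≠ 0)
    (hlim : schurCompl M.limitFim = Matrix.diagonal M.limitInfo) (hpos : ∀ i, 0 < M.limitInfo i) :
    (∀ i, Tendsto (fun G : ℕ => (G : ℝ)⁻¹ * M.effFim s G i i) atTop (𝓝 (M.limitInfo i))) ∧
      ∀ᶠ G : ℕ in atTop, (M.effFim s G).PosDef := by
  have hsc := (continuousAt_schurCompl hdet).tendsto.comp hs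
  rw [hlim] at hsc
  have heff : ∀ G : ℕ, 0 < G →
      schurCompl ((G : ℝ)⁻¹ • M.fim s G) = (G : ℝ)⁻¹ • M.effFim s G := fun G hG => by
    rw [schurCompl_smul (by positivity), effFim_eq]
  refine ⟨fun i => ?_, ?_⟩
  · have h := ((continuous_apply_apply i i).tendsto (Matrix.diagonal M.limitInfo)).comp hsc
    rw [Matrix.diagonal_apply_eq] at h
    refine h.congr' ?_
    filter_upwards [eventually_gt_atTop 0] with G hG
    simp only [Function.comp]
    rw [heff G hG]
    rfl
  · have hcdet : Continuous fun A : Matrix (EtaIdx K) (EtaIdx K) ℝ => A.det := by fun_prop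
    have h1 := (hcdet.tendsto _).comp hsc
    have h1' := h1.eventually_ne (b₂ := 0) (by
      rw [Matrix.det_diagonal]
      exact Finset.prod_ne_zero_iff.2 fun i _ => (hpos i).ne')
    have hc22 : Continuous fun A : Matrix (XiIdx K) (XiIdx K) ℝ => A.toBlocks₂₂.det :=
      (continuous_id.matrix_submatrix Sum.inr Sum.inr).matrix_det
    have h2' := ((hc22.tendsto _).comp hs).eventually_ne hdet
    filter_upwards [h1', h2', eventually_gt_atTop 0] with G h1 h2 hG
    simp only [Function.comp] at h1 h2
    rw [heff G hG, Matrix.det_smul] at h1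
    have h22 : ((G : ℝ)⁻¹ • M.fim s G).toBlocks₂₂ = (G : ℝ)⁻¹ • (M.fim s G).toBlocks₂₂ := rfl
    rw [h22, Matrix.det_smul] at h2
    have hpsd := schurCompl_posSemidef (M.posSemidef_fim s G) (right_ne_zero_of_mul h2)
    exact hpsd.posDef_iff_det_ne_zero.2 (right_ne_zero_of_mul h1)

end SpoofModel

end

theorem proposition1 {K N Nt : ℕ} (hN : 2 ≤ N) (hNt : 2 ≤ Nt) (M : SpoofModel K N Nt)
    (hc : 0 < M.c) (hlam : 0 < M.lam) (hd : M.d = M.lam / 2) (hTs : 0 < M.Ts) (hσ : 0 < M.σ)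
    (hγ : ∀ k, M.γ k ≠ 0) (hcos : ∀ k, Real.cos (M.aodBar k) ≠ 0)
    (kmin : Fin (K + 1)) (hkmin : ∀ k, M.toaBar kmin ≤ M.toaBar k)
    {Ω : Type*} [MeasurableSpace Ω] (P : Measure Ω) [IsProbabilityMeasure P]
    (s : ℕ → Fin N → Ω → (Fin Nt → ℂ))
    (hmeas : ∀ g n, Measurable (s g n))
    (hindep : ∀ n, iIndepFun (fun g => s g n) P)
    (hident : ∀ g n, IdentDistrib (s g n) (s 0 n) P P)
    (hcov : ∀ g n i j, ∫ ω, s g n ω i * conj (s g n ω j) ∂P = if i = j then (1 / Nt : ℂ) else 0)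
    (ψ : ℝ) (hψ : 0 < ψ) :
    ∀ᵐ ω ∂P, ∃ G₀ : ℕ, 0 < G₀ ∧ ∀ G ≥ G₀, M.PathsOrthogonal (fun g n => s g n ω) G →
      ∀ phat : EuclideanSpace ℝ (EtaIdx K) → Plane, Measurable phat →
        M.MSUnbiased (fun g n => s g n ω) G kmin phat →
        ENNReal.ofReal (M.C₁ G ψ kmin
            + M.C₂ G kmin * M.toaBar kmin ^ 2 / Real.cos (M.aodBar kmin) ^ 2
            + ‖M.pseudoPos kmin M.etaBar - M.p‖ ^ 2)
          ≤ M.mse (fun g n => s g n ω) G phat := by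
  have hNt0 : Nt ≠ 0 := by omega
  have hN0 : N ≠ 0 := by omega
  have hd0 : M.d ≠ 0 := by rw [hd]; positivity
  have hSLLN := ae_all_iff.2 fun n : Fin N => ae_tendsto_sample_covariance (fun g => s g n)
    (fun g => hmeas g n) (hindep n) (fun g => hident g n)
    (fun i j => if i = j then (1 / Nt : ℂ) else 0) (by simp [hNt0]) (hcov 0 n)
  filter_upwards [hSLLN] with ω hω
  have hfim := M.tendsto_fim (s := fun g n => s g n ω) hω
  suffices h : ∀ᶠ G : ℕ in atTop, M.PathsOrthogonal (fun g n => s g n ω) G →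
      ∀ phat : EuclideanSpace ℝ (EtaIdx K) → Plane, Measurable phat →
        M.MSUnbiased (fun g n => s g n ω) G kmin phat →
        ENNReal.ofReal (M.C₁ G ψ kmin
            + M.C₂ G kmin * M.toaBar kmin ^ 2 / Real.cos (M.aodBar kmin) ^ 2
            + ‖M.pseudoPos kmin M.etaBar - M.p‖ ^ 2)
          ≤ M.mse (fun g n => s g n ω) G phat by
    obtain ⟨G₀, hG₀⟩ := eventually_atTop.1 h
    exact ⟨G₀ + 1, by omega, fun G hG => hG₀ G (by omega)⟩
  by_cases horth : ∀ i j : XiIdx K, pathOf i ≠ pathOf j → M.limitFim i j = 0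
  swap
  · -- a non-zero limiting cross-path entry excludes orthogonal paths for many pilots
    push Not at horth
    obtain ⟨i, j, hij, hne⟩ := horth
    have h := (((continuous_apply_apply i j).tendsto M.limitFim).comp hfim).eventually_ne hne
    filter_upwards [h] with G hG hPO
    refine absurd ?_ hG
    simp only [Function.comp, Matrix.smul_apply, hPO i j hij, smul_zero]
  obtain ⟨hdet, hlim⟩ := M.schurCompl_limitFim hN0 hNt0 hσ.ne' horth
  have hpos := M.limitInfo_pos hN hNt hlam hd0 hTs hσ hγ hcos
  obtain ⟨hdiag, hPD⟩ := M.tendsto_effFim hfim hdet hlim hpos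
  have hbound := ((tendsto_const_nhds (x := M.c ^ 2)).div (hdiag (0, kmin)) (hpos _).ne').add
    ((tendsto_const_nhds (x := (M.c * M.toaBar kmin) ^ 2)).div (hdiag (1, kmin)) (hpos _).ne')
  filter_upwards [hPD, eventually_gt_atTop 0, hbound.eventually (eventually_gt_nhds
    (sub_lt_self _ hψ))] with G hJ hG hlt _ phat hphat hub
  refine le_trans (ENNReal.ofReal_le_ofReal ?_) (M.le_mse hJ hphat hub)
  gcongr ?_ + _
  have hG' : (0 : ℝ) < G := by exact_mod_cast hG
  have hJ0 : 0 < M.effFim (fun g n => s g n ω) G (0, kmin) (0, kmin) := hJ.diag_pos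
  have hJ1 : 0 < M.effFim (fun g n => s g n ω) G (1, kmin) (1, kmin) := hJ.diag_pos
  have hN2 : (N : ℝ) ^ 2 - 1 ≠ 0 := by
    have : (2 : ℝ) ≤ N := by exact_mod_cast hN
    nlinarith
  have hNt2 : (Nt : ℝ) ^ 2 - 1 ≠ 0 := by
    have : (2 : ℝ) ≤ Nt := by exact_mod_cast hNt
    nlinarith
  have hN' : (N : ℝ) ≠ 0 := by exact_mod_cast hN0
  have hπ := Real.pi_ne_zero
  have hγk := norm_ne_zero_iff.2 (hγ kmin)
  have hck := hcos kmin
  have e0 : M.c ^ 2 / M.limitInfo (0, kmin) + (M.c * M.toaBar kmin) ^ 2 / M.limitInfo (1, kmin) - ψ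
      = G * (M.C₁ G ψ kmin
        + M.C₂ G kmin * M.toaBar kmin ^ 2 / Real.cos (M.aodBar kmin) ^ 2) := by
    simp only [SpoofModel.limitInfo, SpoofModel.C₁, SpoofModel.C₂, Matrix.cons_val_zero,
      Matrix.cons_val_one]
    field_simp
    ring
  rw [e0] at hlt
  have e1 : M.c ^ 2 / ((G : ℝ)⁻¹ * M.effFim (fun g n => s g n ω) G (0, kmin) (0, kmin))
      + (M.c * M.toaBar kmin) ^ 2 /
        ((G : ℝ)⁻¹ * M.effFim (fun g n => s g n ω) G (1, kmin) (1, kmin))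
      = G * (M.c ^ 2 / M.effFim (fun g n => s g n ω) G (0, kmin) (0, kmin)
        + (M.c * M.toaBar kmin) ^ 2 / M.effFim (fun g n => s g n ω) G (1, kmin) (1, kmin)) := by
    field_simp
  simp only [Pi.div_apply] at hlt
  rw [e1] at hlt
  exact (lt_of_mul_lt_mul_left hlt hG'.le).le
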